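/- **Definitions.** A coarse structure on a set $X$ is a family $\mathcal E$ of subsets of $X\times X$ (the controlled sets) that contains the diagonal and is closed under subsets, finite unions, inverses $E^{-1}=\{(x,y):(y,x)\in E\}$ and compositions $E\circ F=\{(x,z):\exists y,\ (x,y)\in E,\ (y,z)\in F\}$; $\langle\mathcal S\rangle$ denotes the smallest coarse structure containing a family $\mathcal S$ of subsets of $X\times X$. For $f:X\times X\to[0,\infty]$ put $\mathcal E_f=\bigcup_{\varepsilon>0}\langle\{(x,y):f(x,y)\ge\varepsilon\}\rangle$. For a function $\widetilde f$ assigning to each pair of subsets of $X$ an element of $[0,\infty]$ and $E\subseteq X\times X$, put $E[x]=\{y:(x,y)\in E\}$ and $\widetilde f_E(x,y)=\widetilde f(E[x],E[y])$, and let $\mathcal E_{\widetilde f}=\bigcup_{n\ge 0}\mathcal E_n$, where $\mathcal E_0=\mathcal E_{\widetilde f_D}$ with $D$ the diagonal and $\mathcal E_{n+1}=\big\langle\bigcup_{E\in\mathcal E_n}\mathcal E_{\widetilde f_E}\big\rangle$. A discrete net of C*-algebras over a countable set $X$ is a unital C*-algebra $A$ together with unital C*-subalgebras $A_F\subseteq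 A$ for the finite subsets $F\subseteq X$ such that $A_F\subseteq A_G$ if $F\subseteq G$, $[A_F,A_G]=0$ if $F\cap G=\varnothing$, and $\bigcup_F A_F$ is dense in $A$. It is locally finite dimensional if every $A_F$ is finite dimensional. For arbitrary $Y\subseteq X$ let $A_Y$ be the C*-subalgebra generated by all $A_F$ with $F\subseteq Y$ finite. The higher-order correlation coarse structure of a state $\phi$ on $A$ is $\mathcal E_{\widetilde\phi}:=\mathcal E_{\widetilde C_\phi}$, where $$\widetilde C_\phi(Y,Z)=\sup\{|\phi(ab)-\phi(a)\phi(b)| : a\in A_Y,\ b\in A_Z,\ \|a\|\le 1,\ \|b\|\le 1\}.$$ A factor state is a state $\phi$ whose GNS representation $\pi_\phi$ generates a factor $\pi_\phi(A)''$. For a group $\Gamma$ with finite generating set $S$, let $\mathcal E_\Gamma$ be the bounded coarse structure of the path metric of the Cayley graph with vertex set $\Gamma$ and edges joining $x$ and $sx$ ($x\in\Gamma$, $s\in S$); it does not depend on $S$. A net $A$ over $\Gamma$ is covariant if it is equipped with an action of $\Gamma$ on $A$ by $*$-automorphisms with $g(A_F)\subseteq A_{Fg^{-1}}$ for all $g\in\Gamma$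 and all finite $F\subseteq\Gamma$. A Hamiltonian on $A$ is the infinitesimal generator $\delta$, with domain $D(\delta)$, of a point-norm continuous one-parameter group $(\alpha_t)_{t\in\mathbb R}$ of $*$-automorphisms of $A$; it is translation invariant if $g(D(\delta))\subseteq D(\delta)$ and $\delta(g(a))=g(\delta(a))$ for all $g\in\Gamma$ and $a\in D(\delta)$. A ground state of $\delta$ is a state $\phi$ with $-i\,\phi(a^*\delta(a))\ge 0$ for all $a\in D(\delta)$. **Theorem.** Let $\Gamma$ be a finitely generated discrete group and $A$ a locally finite dimensional covariant discrete net of C*-algebras over $\Gamma$. For every $\Gamma$-invariant factor state $\phi$ on $A$, $\mathcal E_{\widetilde\phi}\subseteq\mathcal E_\Gamma$. In particular, if $\phi$ is the unique ground state of a translation invariant Hamiltonian on $A$, then $\mathcal E_{\widetilde\phi}\subseteq\mathcal E_\Gamma$. -/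

import Mathlib

open scoped ComplexOrder ENNReal NNReal Topology

/-! ### Coarse structures -/

/-- A coarse structure on a set `X`: a family of subsets of `X × X`, called controlled sets. -/
structure CoarseStructure (X : Type*) where
  controlled : Set (Set (X × X))
  diagonal_mem : Set.diagonal X ∈ controlled
  mem_of_subset : ∀ {E F : Set (X × X)}, F ∈ controlled → E ⊆ F → E ∈ controlled
  union_mem : ∀ {E F : Set (X × X)}, E ∈ controlled → F ∈ controlled → E ∪ F ∈ controlled
  inv_mem : ∀ {E : Set (X × X)}, E ∈ controlled → {p | (p.2, p.1) ∈ E} ∈ controlled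
  comp_mem : ∀ {E F : Set (X × X)}, E ∈ controlled → F ∈ controlled →
    {p : X × X | ∃ y, (p.1, y) ∈ E ∧ (y, p.2) ∈ F} ∈ controlled

namespace CoarseStructure

variable {X : Type*}

/-- The coarse structure `⟨𝒮⟩` generated by a family `𝒮` of subsets of `X × X`: the intersection
of all coarse structures containing `𝒮`. -/
def generate (𝒮 : Set (Set (X × X))) : CoarseStructure X where
  controlled := {E | ∀ 𝓔 : CoarseStructure X, 𝒮 ⊆ 𝓔.controlled → E ∈ 𝓔.controlled}
  diagonal_mem := fun 𝓔 _ => 𝓔.diagonal_mem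
  mem_of_subset := fun hF h 𝓔 h𝓔 => 𝓔.mem_of_subset (hF 𝓔 h𝓔) h
  union_mem := fun hE hF 𝓔 h𝓔 => 𝓔.union_mem (hE 𝓔 h𝓔) (hF 𝓔 h𝓔)
  inv_mem := fun hE 𝓔 h𝓔 => 𝓔.inv_mem (hE 𝓔 h𝓔)
  comp_mem := fun hE hF 𝓔 h𝓔 => 𝓔.comp_mem (hE 𝓔 h𝓔) (hF 𝓔 h𝓔)

theorem subset_generate (𝒮 : Set (Set (X × X))) : 𝒮 ⊆ (generate 𝒮).controlled :=
  fun _ hE _ h => h hE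

theorem generate_subset {𝒮 : Set (Set (X × X))} {𝓔 : CoarseStructure X}
    (h : 𝒮 ⊆ 𝓔.controlled) : (generate 𝒮).controlled ⊆ 𝓔.controlled :=
  fun _ hE => hE 𝓔 h

/-- The union of a nonempty directed family of coarse structures. -/
def directedUnion {ι : Type*} [Nonempty ι] (𝓔 : ι → CoarseStructure X)
    (h : ∀ i j, ∃ k, (𝓔 i).controlled ⊆ (𝓔 k).controlled ∧
      (𝓔 j).controlled ⊆ (𝓔 k).controlled) : CoarseStructure X where
  controlled := ⋃ i, (𝓔 i).controlled
  diagonal_mem := Set.mem_iUnion.2 ⟨Classical.arbitrary ι, (𝓔 _).diagonal_mem⟩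
  mem_of_subset := by
    intro E F hF hEF
    obtain ⟨i, hi⟩ := Set.mem_iUnion.1 hF
    exact Set.mem_iUnion.2 ⟨i, (𝓔 i).mem_of_subset hi hEF⟩
  union_mem := by
    intro E F hE hF
    obtain ⟨i, hi⟩ := Set.mem_iUnion.1 hE
    obtain ⟨j, hj⟩ := Set.mem_iUnion.1 hF
    obtain ⟨k, hik, hjk⟩ := h i j
    exact Set.mem_iUnion.2 ⟨k, (𝓔 k).union_mem (hik hi) (hjk hj)⟩
  inv_mem := by
    intro E hE
    obtain ⟨i, hi⟩ := Set.mem_iUnion.1 hE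
    exact Set.mem_iUnion.2 ⟨i, (𝓔 i).inv_mem hi⟩
  comp_mem := by
    intro E F hE hF
    obtain ⟨i, hi⟩ := Set.mem_iUnion.1 hE
    obtain ⟨j, hj⟩ := Set.mem_iUnion.1 hF
    obtain ⟨k, hik, hjk⟩ := h i j
    exact Set.mem_iUnion.2 ⟨k, (𝓔 k).comp_mem (hik hi) (hjk hj)⟩

/-- The bounded coarse structure of the path metric of a graph (the distance between vertices in
different components is `∞`). -/
def ofGraph (G : SimpleGraph X) : CoarseStructure X where
  controlled := {E | ∃ R : ℕ, ∀ p ∈ E, G.edist p.1 p.2 ≤ R}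
  diagonal_mem := ⟨0, by
    rintro ⟨x, y⟩ (h : x = y)
    simp [h]⟩
  mem_of_subset := fun ⟨R, hR⟩ h => ⟨R, fun p hp => hR p (h hp)⟩
  union_mem := by
    rintro E F ⟨R, hR⟩ ⟨T, hT⟩
    refine ⟨max R T, fun p hp => hp.elim (fun h => (hR p h).trans ?_) fun h => (hT p h).trans ?_⟩
    · exact_mod_cast le_max_left R T
    · exact_mod_cast le_max_right R T
  inv_mem := by
    rintro E ⟨R, hR⟩
    refine ⟨R, fun p hp => ?_⟩
    rw [SimpleGraph.edist_comm]
    exact hR _ hp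
  comp_mem := by
    rintro E F ⟨R, hR⟩ ⟨T, hT⟩
    refine ⟨R + T, ?_⟩
    rintro p ⟨y, h₁, h₂⟩
    push_cast
    exact SimpleGraph.edist_triangle.trans (add_le_add (hR (p.1, y) h₁) (hT (y, p.2) h₂))

/-- The superlevel set `E_{f,ε} = {(x, y) | f(x, y) ≥ ε}`. -/
def superlevel (f : X → X → ℝ≥0∞) (ε : ℝ≥0) : Set (X × X) :=
  {p | (ε : ℝ≥0∞) ≤ f p.1 p.2}

/-- The universal coarse structure `𝓔_f = ⋃_{ε > 0} ⟨E_{f,ε}⟩` of a function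
`f : X × X → [0, ∞]`. -/
def ofFunction (f : X → X → ℝ≥0∞) : CoarseStructure X :=
  directedUnion (ι := {ε : ℝ≥0 // 0 < ε}) (fun ε => generate {superlevel f ε}) (by
    have key : ∀ a b : ℝ≥0, a ≤ b → (generate {superlevel f b}).controlled ⊆
        (generate {superlevel f a}).controlled := by
      intro a b hab
      refine generate_subset ?_
      rintro _ rfl
      refine (generate _).mem_of_subset (subset_generate _ rfl) fun p hp => ?_
      exact le_trans (by exact_mod_cast hab) (show (b : ℝ≥0∞) ≤ f p.1 p.2 from hp)
    rintro ⟨a, ha⟩ ⟨b, hb⟩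
    exact ⟨⟨min a b, lt_min ha hb⟩, key _ _ (min_le_left a b), key _ _ (min_le_right a b)⟩)

/-- The `E`-ball `E[x] = {y | (x, y) ∈ E}`. -/
def ball (E : Set (X × X)) (x : X) : Set X := {y | (x, y) ∈ E}

/-- The rescaling `f_E(x, y) = f(E[x], E[y])` of a function `f` of pairs of subsets. -/
def rescale (f : Set X → Set X → ℝ≥0∞) (E : Set (X × X)) : X → X → ℝ≥0∞ :=
  fun x y => f (ball E x) (ball E y)

/-- The increasing sequence of coarse structures `𝓔₀ = 𝓔_{f_D}`, with `D` the diagonal, and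
`𝓔ₙ₊₁ = ⟨⋃_{E ∈ 𝓔ₙ} 𝓔_{f_E}⟩`. -/
def higherStep (f : Set X → Set X → ℝ≥0∞) : ℕ → CoarseStructure X
  | 0 => ofFunction (rescale f (Set.diagonal X))
  | n + 1 => generate (⋃ E ∈ (higherStep f n).controlled, (ofFunction (rescale f E)).controlled)

theorem higherStep_subset_succ (f : Set X → Set X → ℝ≥0∞) (n : ℕ) :
    (higherStep f n).controlled ⊆ (higherStep f (n + 1)).controlled := by
  induction n with
  | zero =>
    intro E hE
    exact subset_generate _ (Set.mem_biUnion (higherStep f 0).diagonal_mem hE)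
  | succ n ih =>
    refine generate_subset (Set.Subset.trans ?_ (subset_generate _))
    exact Set.biUnion_subset_biUnion_left ih

/-- The universal coarse structure `⋃ₙ 𝓔ₙ` for higher order controlled decay of a function `f` of
pairs of subsets of `X`. -/
def ofHigherFunction (f : Set X → Set X → ℝ≥0∞) : CoarseStructure X :=
  directedUnion (higherStep f) (fun i j =>
    have hm : Monotone fun n => (higherStep f n).controlled :=
      monotone_nat_of_le_succ (higherStep_subset_succ f)
    ⟨max i j, hm (le_max_left i j), hm (le_max_right i j)⟩)

end CoarseStructure

/-- The Cayley graph of a group with respect to `S`: `x` and `y` are joined by an edge if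
`y = s x` for some `s ∈ S` (or vice versa). -/
def cayleyGraph {Γ : Type*} [Group Γ] (S : Set Γ) : SimpleGraph Γ :=
  SimpleGraph.fromRel fun x y => ∃ s ∈ S, y = s * x

/-! ### Discrete nets of C*-algebras -/

/-- A discrete net of C*-algebras over `X` with quasi-local algebra `A`. -/
structure DiscreteNet (X A : Type*) [CStarAlgebra A] where
  loc : Finset X → StarSubalgebra ℂ A
  isClosed_loc : ∀ F, IsClosed (loc F : Set A)
  mono : ∀ {F G : Finset X}, F ⊆ G → loc F ≤ loc G
  commute : ∀ {F G : Finset X}, Disjoint F G → ∀ a ∈ loc F, ∀ b ∈ loc G, a * b = b * a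
  dense : Dense (⋃ F, (loc F : Set A))

namespace DiscreteNet

variable {X A : Type*} [CStarAlgebra A]

/-- The algebra `A_Y` of an arbitrary region `Y ⊆ X`: the C*-algebra generated by the local
algebras of the finite subsets of `Y`. -/
def region (N : DiscreteNet X A) (Y : Set X) : StarSubalgebra ℂ A :=
  (⨆ F : {F : Finset X // (F : Set X) ⊆ Y}, N.loc F).topologicalClosure

/-- All local algebras are finite dimensional. -/
def LocallyFiniteDimensional (N : DiscreteNet X A) : Prop :=
  ∀ F, FiniteDimensional ℂ (N.loc F)

/-- An action `ρ` of `Γ` on the quasi-local algebra of a net over `Γ` is covariant if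
`ρ_g(A_F) ⊆ A_{F g⁻¹}`. -/
def IsCovariant {Γ : Type*} [Group Γ] (N : DiscreteNet Γ A) (ρ : Γ →* (A ≃⋆ₐ[ℂ] A)) : Prop :=
  ∀ (g : Γ) (F : Finset Γ), ∀ a ∈ N.loc F,
    ρ g a ∈ N.loc (F.map (Equiv.mulRight g⁻¹).toEmbedding)

end DiscreteNet

/-! ### States and correlations -/

/-- A state on a unital C*-algebra: a positive linear functional of norm one. -/
structure CStarState (A : Type*) [CStarAlgebra A] where
  toCLM : A →L[ℂ] ℂ
  norm_eq_one : ‖toCLM‖ = 1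
  nonneg : ∀ a, 0 ≤ toCLM (star a * a)

noncomputable section

namespace CStarState

variable {A : Type*} [CStarAlgebra A]

instance : CoeFun (CStarState A) (fun _ => A → ℂ) := ⟨fun φ => φ.toCLM⟩

/-- The higher order correlation function
`C(Y, Z) = sup {|φ(ab) - φ(a)φ(b)| : a ∈ A_Y, b ∈ A_Z, ‖a‖, ‖b‖ ≤ 1}`. -/
def higherCorrelation {X : Type*} (φ : CStarState A) (N : DiscreteNet X A) (Y Z : Set X) : ℝ≥0∞ :=
  ⨆ (a ∈ N.region Y) (b ∈ N.region Z) (_ : ‖a‖ ≤ 1) (_ : ‖b‖ ≤ 1), ‖φ (a * b) - φ a * φ b‖ₑ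

/-- The higher order correlation coarse structure of a state. -/
def higherCorrelationCoarse {X : Type*} (φ : CStarState A) (N : DiscreteNet X A) :
    CoarseStructure X :=
  CoarseStructure.ofHigherFunction (φ.higherCorrelation N)

/-- Invariance of a state under a group action by automorphisms. -/
def IsInvariant {Γ : Type*} [Group Γ] (φ : CStarState A) (ρ : Γ →* (A ≃⋆ₐ[ℂ] A)) : Prop :=
  ∀ g a, φ (ρ g a) = φ a

/-- A state as a positive linear map. -/
def toPositive [PartialOrder A] [StarOrderedRing A] (φ : CStarState A) : A →ₚ[ℂ] ℂ :=
  PositiveLinearMap.mk₀ φ.toCLM.toLinearMap (by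
    intro x hx
    obtain ⟨a, rfl⟩ := CStarAlgebra.nonneg_iff_eq_star_mul_self.1 hx
    exact φ.nonneg a)

/-- The von Neumann algebra `π_φ(A)''` generated by the GNS representation of a state. -/
def gnsVonNeumann [PartialOrder A] [StarOrderedRing A] (φ : CStarState A) :
    VonNeumannAlgebra φ.toPositive.GNS where
  toStarSubalgebra := StarSubalgebra.centralizer ℂ
    (StarSubalgebra.centralizer ℂ (Set.range φ.toPositive.gnsStarAlgHom) :
      Set (φ.toPositive.GNS →L[ℂ] φ.toPositive.GNS))
  centralizer_centralizer' := by simp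

end CStarState

/-- A von Neumann algebra is a factor if its center consists of the scalars. -/
def VonNeumannAlgebra.IsFactor {H : Type*} [NormedAddCommGroup H] [InnerProductSpace ℂ H]
    [CompleteSpace H] (M : VonNeumannAlgebra H) : Prop :=
  ∀ z ∈ M, z ∈ M.commutant → ∃ c : ℂ, z = c • (1 : H →L[ℂ] H)

/-- A factor state is a state whose GNS representation generates a factor. -/
def CStarState.IsFactorState {A : Type*} [CStarAlgebra A] [PartialOrder A] [StarOrderedRing A]
    (φ : CStarState A) : Prop :=
  φ.gnsVonNeumann.IsFactor

/-! ### Hamiltonians and ground states -/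

/-- A continuous time evolution: a homomorphism `ℝ → Aut(A)` that is continuous in the point norm
topology. -/
structure TimeEvolution (A : Type*) [CStarAlgebra A] where
  toHom : Multiplicative ℝ →* (A ≃⋆ₐ[ℂ] A)
  continuous_apply : ∀ a, Continuous fun t : ℝ => toHom (Multiplicative.ofAdd t) a

variable {A : Type*} [CStarAlgebra A]

/-- The infinitesimal generator `δ(a) = d/dt α_t(a) |_{t=0}` of a time evolution, defined on all
`a` for which the derivative exists in norm. -/
def TimeEvolution.generator (α : TimeEvolution A) : A →ₗ.[ℂ] A where
  domain :=
    { carrier := {a | DifferentiableAt ℝ (fun t : ℝ => α.toHom (Multiplicative.ofAdd t) a) 0}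
      add_mem' := by
        intro a b ha hb
        simp only [Set.mem_ofPred_eq, map_add] at *
        exact DifferentiableAt.fun_add ha hb
      zero_mem' := by simp
      smul_mem' := by
        intro c a ha
        simp only [Set.mem_ofPred_eq, map_smul] at *
        exact DifferentiableAt.fun_const_smul ha c }
  toFun :=
    { toFun := fun a => deriv (fun t : ℝ => α.toHom (Multiplicative.ofAdd t) (a : A)) 0
      map_add' := by
        rintro ⟨a, ha⟩ ⟨b, hb⟩
        simp only [Submodule.coe_add, map_add]
        exact deriv_fun_add ha hb
      map_smul' := by
        rintro c ⟨a, ha⟩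
        simp only [Submodule.coe_smul, map_smul, RingHom.id_apply]
        exact deriv_fun_const_smul c ha }

/-- A Hamiltonian on `A` is an (in general unbounded) operator on `A` that is the infinitesimal
generator of a time evolution. -/
def IsHamiltonian (δ : A →ₗ.[ℂ] A) : Prop :=
  ∃ α : TimeEvolution A, δ = α.generator

/-- A Hamiltonian is invariant under an action `ρ` if `ρ_g(D(δ)) ⊆ D(δ)` and
`δ(ρ_g(a)) = ρ_g(δ(a))` for all `g` and all `a ∈ D(δ)`. -/
def IsTranslationInvariant {Γ : Type*} [Group Γ] (δ : A →ₗ.[ℂ] A) (ρ : Γ →* (A ≃⋆ₐ[ℂ] A)) :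
    Prop :=
  ∀ (g : Γ) (a : δ.domain), ∃ h : ρ g (a : A) ∈ δ.domain, δ ⟨ρ g (a : A), h⟩ = ρ g (δ a)

/-- A ground state of `δ` is a state with `-i φ(a* δ(a)) ≥ 0` for all `a ∈ D(δ)`. With
`δ(a) = i[H, a]` this is `φ(a* [H, a]) ≥ 0`. -/
def CStarState.IsGroundState (φ : CStarState A) (δ : A →ₗ.[ℂ] A) : Prop :=
  ∀ a : δ.domain, 0 ≤ -Complex.I * φ (star (a : A) * δ a)

/-- `φ` is the unique ground state of `δ`. -/
def CStarState.IsUniqueGroundState (φ : CStarState A) (δ : A →ₗ.[ℂ] A) : Prop :=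
  φ.IsGroundState δ ∧ ∀ ψ : CStarState A, ψ.IsGroundState δ → ψ = φ

end

/-! ### The bounded coarse structure of a finitely generated group -/

section Cayley

variable {Γ : Type*} [Group Γ]

/-! Edges of the Cayley graph are left multiplications, so a set is controlled iff the quotients `y
* x⁻¹` of its pairs lie in a finite set, a condition unchanged by the right translations through
which `Γ` acts on the net. By `ofHigherFunction_subset` it is enough that rescaling by a controlled
`E` gives controlled superlevel sets. If the quotients of `E` lie in `K`, translating by `x` moves
`E[x]` into the fixed finite set `K`. Clustering provides a finite `G` such that `K` is almost
uncorrelated with the complement of `G`. So a large correlation forces the translate of `E[y]` to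
meet `G`, and then `y * x⁻¹` lies in the finite set `K⁻¹G`.

Clustering (`exists_finset_norm_correlation_lt`) is a compactness argument. If it fails, there are
bad pairs `a G`, `b G` with `b G` supported off `G`. Along an ultrafilter `b G` has a weak limit,
which commutes with every local algebra and lies in the bicommutant, so it is a scalar. Finite
dimensionality makes `a G` converge in norm, and the correlation tends to zero.

For a unique ground state, invariance holds because a symmetry carries ground states to ground
states. For the factor property, let `w` be self-adjoint and central and let `ω = wΩ`. The conjugate
of `w` by the implementing unitary `U_t` commutes with `w`, so `⟨ω, U_t ω⟩` is real. Morally, its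
spectral measure is symmetric, while positivity of the energy puts it on a half-line; hence `U_t ω =
ω`. The proof replaces spectral theory by the Cauchy–Schwarz inequality for the energy form, tested
on orbit integrals, which lie in the domain of the generator. Then `ω` also gives a ground state,
uniqueness makes `w * w` a scalar, and applying this to `w + 1` as well makes `w` a scalar. -/

open scoped Pointwise in
theorem cayleyGraph_walk_mem_pow (S : Set Γ) {x y : Γ} (w : (cayleyGraph S).Walk x y) :
    y * x⁻¹ ∈ (S ∪ S⁻¹) ^ w.length := by
  induction w with
  | nil => simp
  | @cons u v z h p ih =>
    have hvu : v * u⁻¹ ∈ S ∪ S⁻¹ := by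
      rcases ((SimpleGraph.fromRel_adj _ _ _).1 h).2 with ⟨s, hs, rfl⟩ | ⟨s, hs, rfl⟩
      · left; simpa using hs
      · right; simpa using hs
    rw [SimpleGraph.Walk.length_cons, pow_succ]
    exact Set.mem_mul.2 ⟨_, ih, _, hvu, by group⟩

/-- A word for `k` in the generators traces a path from `x` to `k * x` whose length does not depend
on `x`. -/
theorem exists_edist_mul_left_le {S : Set Γ} (hS : Subgroup.closure S = ⊤) (k : Γ) :
    ∃ n : ℕ, ∀ x, (cayleyGraph S).edist x (k * x) ≤ n := by
  have hk : k ∈ Subgroup.closure S := hS ▸ Subgroup.mem_top k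
  induction hk using Subgroup.closure_induction with
  | mem s hs =>
    refine ⟨1, fun x => ?_⟩
    -- `fromRel` has no loops, so the generator `s = 1` gives no edge and is treated separately.
    by_cases h : x = s * x
    · rw [← h]; simp
    · have hadj : (cayleyGraph S).Adj x (s * x) :=
        (SimpleGraph.fromRel_adj _ _ _).2 ⟨h, Or.inl ⟨s, hs, rfl⟩⟩
      exact_mod_cast (SimpleGraph.edist_eq_one_iff_adj.2 hadj).le
  | one => exact ⟨0, fun x => by simp⟩
  | mul a b _ _ ha hb =>
    obtain ⟨m, hm⟩ := ha
    obtain ⟨n, hn⟩ := hb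
    refine ⟨n + m, fun x => ?_⟩
    push_cast
    rw [mul_assoc]
    exact SimpleGraph.edist_triangle.trans (add_le_add (hn x) (hm (b * x)))
  | inv a _ ha =>
    obtain ⟨m, hm⟩ := ha
    refine ⟨m, fun x => ?_⟩
    rw [SimpleGraph.edist_comm]
    simpa using hm (a⁻¹ * x)

open scoped Pointwise in
/-- A set is controlled for the Cayley graph iff the quotients `y x⁻¹` of its members lie in a
finite set. -/
theorem mem_ofGraph_cayleyGraph_iff {S : Set Γ} (hfin : S.Finite)
    (hS : Subgroup.closure S = ⊤) (E : Set (Γ × Γ)) :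
    E ∈ (CoarseStructure.ofGraph (cayleyGraph S)).controlled ↔
      ∃ K : Finset Γ, ∀ p ∈ E, p.2 * p.1⁻¹ ∈ K := by
  constructor
  · rintro ⟨R, hR⟩
    have hpow : ∀ n : ℕ, ((S ∪ S⁻¹) ^ n).Finite := by
      intro n
      induction n with
      | zero => simp
      | succ n ih => rw [pow_succ]; exact ih.mul (hfin.union hfin.inv)
    -- The words of length at most `R` in the generators and their inverses.
    have hfinite : (⋃ n ∈ Finset.range (R + 1), (S ∪ S⁻¹) ^ n).Finite :=
      Set.Finite.biUnion (Finset.finite_toSet _) fun n _ => hpow n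
    refine ⟨hfinite.toFinset, fun p hp => ?_⟩
    have hle := hR p hp
    obtain ⟨w, hw⟩ := (SimpleGraph.reachable_of_edist_ne_top
      (ne_top_of_le_ne_top (ENat.natCast_ne_top R) hle)).exists_walk_length_eq_edist
    rw [← hw] at hle
    have hlen : w.length ≤ R := by exact_mod_cast hle
    rw [Set.Finite.mem_toFinset]
    exact Set.mem_biUnion (by simpa using Nat.lt_succ_of_le hlen) (cayleyGraph_walk_mem_pow S w)
  · rintro ⟨K, hK⟩
    choose n hn using exists_edist_mul_left_le hS
    refine ⟨K.sup n, fun p hp => ?_⟩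
    have h := hn (p.2 * p.1⁻¹) p.1
    rw [inv_mul_cancel_right] at h
    exact h.trans (by exact_mod_cast Finset.le_sup (hK p hp))

end Cayley

/-! ### Coarse structures closed under rescaling -/

namespace CoarseStructure

variable {X : Type*}

/-- If `𝓔` contains the superlevel sets of all rescalings of `f` by its own members, then it
contains the higher order coarse structure of `f`. -/
theorem ofHigherFunction_subset {f : Set X → Set X → ℝ≥0∞} {𝓔 : CoarseStructure X}
    (h : ∀ E ∈ 𝓔.controlled, ∀ ε : ℝ≥0, 0 < ε → superlevel (rescale f E) ε ∈ 𝓔.controlled) :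
    (ofHigherFunction f).controlled ⊆ 𝓔.controlled := by
  have hof : ∀ E ∈ 𝓔.controlled, (ofFunction (rescale f E)).controlled ⊆ 𝓔.controlled := by
    intro E hE
    refine Set.iUnion_subset fun ε => generate_subset ?_
    rintro _ rfl
    exact h E hE ε ε.2
  refine Set.iUnion_subset fun n => ?_
  induction n with
  | zero => exact hof _ 𝓔.diagonal_mem
  | succ n ih => exact generate_subset (Set.iUnion₂_subset fun E hE => hof E (ih hE))

end CoarseStructure

/-! ### Region algebras -/

namespace DiscreteNet

variable {X A : Type*} [CStarAlgebra A]

theorem region_mono (N : DiscreteNet X A) {Y Z : Set X} (h : Y ⊆ Z) :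
    N.region Y ≤ N.region Z := by
  refine StarSubalgebra.topologicalClosure_mono (iSup_le fun F => ?_)
  exact le_iSup (fun F : {F : Finset X // (F : Set X) ⊆ Z} => N.loc F) ⟨F.1, F.2.trans h⟩

theorem region_le_of_isClosed (N : DiscreteNet X A) {Y : Set X} {B : StarSubalgebra ℂ A}
    (hB : IsClosed (B : Set A)) (h : ∀ F : Finset X, (F : Set X) ⊆ Y → N.loc F ≤ B) :
    N.region Y ≤ B :=
  StarSubalgebra.topologicalClosure_minimal (iSup_le fun F => h F.1 F.2) hB

theorem loc_le_region (N : DiscreteNet X A) {Y : Set X} {F : Finset X} (h : (F : Set X) ⊆ Y) :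
    N.loc F ≤ N.region Y :=
  (le_iSup (fun F : {F : Finset X // (F : Set X) ⊆ Y} => N.loc F) ⟨F, h⟩).trans
    (StarSubalgebra.le_topologicalClosure _)

theorem region_coe_le_loc (N : DiscreteNet X A) (F : Finset X) :
    N.region (F : Set X) ≤ N.loc F :=
  N.region_le_of_isClosed (N.isClosed_loc F) fun _ hG => N.mono (by exact_mod_cast hG)

/-- The algebra of the complement of `G` commutes with the algebra of `G`. -/
theorem commute_loc_region_compl (N : DiscreteNet X A) (G : Finset X) {a b : A}
    (ha : a ∈ N.loc G) (hb : b ∈ N.region (G : Set X)ᶜ) : a * b = b * a := by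
  -- The centralizer of `A_G` is a closed star subalgebra, so it suffices to check finite regions
  -- disjoint from `G`.
  have hle : N.region (G : Set X)ᶜ ≤ StarSubalgebra.centralizer ℂ (N.loc G : Set A) := by
    refine N.region_le_of_isClosed ?_ fun F hF b hb => ?_
    · rw [StarSubalgebra.coe_centralizer]
      exact Set.isClosed_centralizer _
    · have hd : Disjoint G F := by
        rw [← Finset.disjoint_coe]
        exact (Set.disjoint_left.2 fun x hx hG => hF hx hG).symm
      exact StarSubalgebra.mem_centralizer_iff ℂ |>.2 fun g hg =>
        ⟨N.commute hd g hg b hb, N.commute hd _ (star_mem hg) b hb⟩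
  exact ((StarSubalgebra.mem_centralizer_iff ℂ).1 (hle hb) a ha).1

theorem IsCovariant.apply_mem_region {Γ : Type*} [Group Γ] {N : DiscreteNet Γ A}
    {ρ : Γ →* (A ≃⋆ₐ[ℂ] A)} (hρ : N.IsCovariant ρ) (g : Γ) {Y : Set Γ} {a : A}
    (ha : a ∈ N.region Y) : ρ g a ∈ N.region ((fun y => y * g⁻¹) '' Y) := by
  have hcont : Continuous (ρ g) := (StarAlgEquiv.isometry (ρ g)).continuous
  have hle : N.region Y ≤ (N.region ((fun y => y * g⁻¹) '' Y)).comap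
      (StarAlgHomClass.toStarAlgHom (ρ g)) := by
    refine N.region_le_of_isClosed ?_ fun F hF b hb => ?_
    · exact (StarSubalgebra.isClosed_topologicalClosure _).preimage hcont
    · refine N.loc_le_region ?_ (hρ g F b hb)
      intro x hx
      simp only [Finset.coe_map, Set.mem_image] at hx
      obtain ⟨y, hy, rfl⟩ := hx
      exact ⟨y, hF hy, rfl⟩
  exact hle ha

end DiscreteNet

theorem CStarState.higherCorrelation_mono {X A : Type*} [CStarAlgebra A] (φ : CStarState A)
    (N : DiscreteNet X A) {Y Y' Z Z' : Set X} (hY : Y ⊆ Y') (hZ : Z ⊆ Z') :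
    φ.higherCorrelation N Y Z ≤ φ.higherCorrelation N Y' Z' := by
  refine iSup₂_le fun a ha => iSup₂_le fun b hb => iSup₂_le fun ha1 hb1 => ?_
  exact le_iSup₂_of_le a (N.region_mono hY ha) (le_iSup₂_of_le b (N.region_mono hZ hb)
    (le_iSup₂_of_le ha1 hb1 le_rfl))

/-- The automorphism `ρ g` is isometric and preserves `φ`, so it carries each competitor in one
supremum to a competitor in the other with the same correlation. This is what allows a ball to be
moved to a base point. -/
theorem CStarState.IsInvariant.higherCorrelation_le {Γ A : Type*} [Group Γ] [CStarAlgebra A]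
    {φ : CStarState A} {N : DiscreteNet Γ A} {ρ : Γ →* (A ≃⋆ₐ[ℂ] A)} (hφ : φ.IsInvariant ρ)
    (hρ : N.IsCovariant ρ) (g : Γ) (Y Z : Set Γ) :
    φ.higherCorrelation N Y Z ≤
      φ.higherCorrelation N ((fun y => y * g⁻¹) '' Y) ((fun y => y * g⁻¹) '' Z) := by
  refine iSup₂_le fun a ha => iSup₂_le fun b hb => iSup₂_le fun ha1 hb1 => ?_
  have hnorm : ∀ c, ‖ρ g c‖ = ‖c‖ := fun c => StarAlgEquiv.norm_map (ρ g) c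
  refine le_iSup₂_of_le (ρ g a) (hρ.apply_mem_region g ha)
    (le_iSup₂_of_le (ρ g b) (hρ.apply_mem_region g hb)
      (le_iSup₂_of_le ((hnorm a).trans_le ha1) ((hnorm b).trans_le hb1) ?_))
  rw [← map_mul (ρ g) a b, hφ, hφ, hφ]

/-! ### Weak limits of bounded families of operators -/

/-- The unit ball of `B(H)` is compact in the weak operator topology, in terms of ultrafilters. -/
theorem exists_weak_limit_of_norm_le_one {H ι : Type*} [NormedAddCommGroup H]
    [InnerProductSpace ℂ H] [CompleteSpace H] (𝒰 : Ultrafilter ι) (T : ι → H →L[ℂ] H)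
    (hT : ∀ i, ‖T i‖ ≤ 1) :
    ∃ z : H →L[ℂ] H, ∀ ξ η : H,
      Filter.Tendsto (fun i => inner ℂ ξ (T i η)) 𝒰 (𝓝 (inner ℂ ξ (z η))) := by
  have hbound : ∀ ξ η i, ‖inner ℂ ξ (T i η)‖ ≤ ‖ξ‖ * ‖η‖ := fun ξ η i =>
    (norm_inner_le_norm _ _).trans (mul_le_mul_of_nonneg_left
      (((T i).le_opNorm η).trans (mul_le_of_le_one_left (norm_nonneg _) (hT i))) (norm_nonneg _))
  have hlim : ∀ ξ η, ∃ c : ℂ, ‖c‖ ≤ ‖ξ‖ * ‖η‖ ∧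
      Filter.Tendsto (fun i => inner ℂ ξ (T i η)) 𝒰 (𝓝 c) := by
    intro ξ η
    obtain ⟨c, hc, h⟩ := (isCompact_closedBall (0 : ℂ) (‖ξ‖ * ‖η‖)).ultrafilter_le_nhds'
      (𝒰.map fun i => inner ℂ ξ (T i η))
      (Filter.mem_map.2 (Filter.Eventually.of_forall fun i => by simpa using hbound ξ η i))
    exact ⟨c, by simpa using hc, h⟩
  choose L hL hlim using hlim
  -- The pointwise limits form a bounded sesquilinear form. The operator that represents it acts in
  -- the first slot of the inner product, hence the adjoint in the witness below.
  let B : H →L⋆[ℂ] H →L[ℂ] ℂ := LinearMap.mkContinuous₂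
    (LinearMap.mk₂'ₛₗ (starRingEnd ℂ) (RingHom.id ℂ) L
      (fun ξ₁ ξ₂ η => tendsto_nhds_unique (hlim _ _)
        (by simpa only [inner_add_left] using (hlim ξ₁ η).add (hlim ξ₂ η)))
      (fun c ξ η => tendsto_nhds_unique (hlim _ _)
        (by simpa only [inner_smul_left, smul_eq_mul] using (hlim ξ η).const_mul _))
      (fun ξ η₁ η₂ => tendsto_nhds_unique (hlim _ _)
        (by simpa only [map_add, inner_add_right] using (hlim ξ η₁).add (hlim ξ η₂)))
      (fun c ξ η => tendsto_nhds_unique (hlim _ _)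
        (by simpa only [map_smul, inner_smul_right, smul_eq_mul, RingHom.id_apply] using
          (hlim ξ η).const_mul _))) 1
    (fun ξ η => by simpa using hL ξ η)
  refine ⟨ContinuousLinearMap.adjoint (InnerProductSpace.continuousLinearMapOfBilin B),
    fun ξ η => ?_⟩
  rw [ContinuousLinearMap.adjoint_inner_right,
    InnerProductSpace.continuousLinearMapOfBilin_apply]
  exact hlim ξ η

/-- An operator commuting eventually with a weakly convergent family commutes with its limit. -/
theorem commute_of_tendsto_inner {H ι : Type*} [NormedAddCommGroup H]
    [InnerProductSpace ℂ H] [CompleteSpace H] {l : Filter ι} [l.NeBot] {T : ι → H →L[ℂ] H}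
    {z : H →L[ℂ] H}
    (hz : ∀ ξ η : H, Filter.Tendsto (fun i => inner ℂ ξ (T i η)) l (𝓝 (inner ℂ ξ (z η))))
    {S : H →L[ℂ] H} (hS : ∀ᶠ i in l, Commute S (T i)) : Commute S z := by
  refine ContinuousLinearMap.ext fun η => ext_inner_left ℂ fun ξ => ?_
  refine tendsto_nhds_unique (f := fun i => inner ℂ ξ (S (T i η))) (l := l) ?_ ?_
  · simp only [mul_apply_eq_comp, ← ContinuousLinearMap.adjoint_inner_left S]
    exact hz _ _
  · refine (hz ξ (S η)).congr' ?_
    filter_upwards [hS] with i hi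
    exact congrArg (inner ℂ ξ) (congrArg (fun R : H →L[ℂ] H => R η) hi.eq.symm)

noncomputable section

/-! ### The cyclic GNS representation of a state -/

namespace CStarState

variable {A : Type*} [CStarAlgebra A] [PartialOrder A] [StarOrderedRing A]

/-- The GNS representation of a state. -/
abbrev rep (φ : CStarState A) :
    A →⋆ₐ[ℂ] (φ.toPositive.GNS →L[ℂ] φ.toPositive.GNS) :=
  φ.toPositive.gnsStarAlgHom

/-- The canonical map `a ↦ π_φ(a) Ω_φ` from the algebra to the GNS space. -/
def gnsMap (φ : CStarState A) : A →ₗ[ℂ] φ.toPositive.GNS :=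
  (UniformSpace.Completion.toComplL (𝕜 := ℂ) (E := φ.toPositive.PreGNS)).toLinearMap ∘ₗ
    φ.toPositive.toPreGNS.toLinearMap

theorem inner_gnsMap (φ : CStarState A) (a b : A) :
    inner ℂ (φ.gnsMap a) (φ.gnsMap b) = φ (star a * b) :=
  UniformSpace.Completion.inner_coe (𝕜 := ℂ) (φ.toPositive.toPreGNS a) (φ.toPositive.toPreGNS b)

theorem rep_gnsMap (φ : CStarState A) (a b : A) : φ.rep a (φ.gnsMap b) = φ.gnsMap (a * b) :=
  φ.toPositive.gnsNonUnitalStarAlgHom_apply_coe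

theorem denseRange_gnsMap (φ : CStarState A) : DenseRange φ.gnsMap :=
  UniformSpace.Completion.denseRange_coe.comp φ.toPositive.toPreGNS.surjective.denseRange
    (UniformSpace.Completion.continuous_coe _)

theorem norm_rep_le (φ : CStarState A) (a : A) : ‖φ.rep a‖ ≤ ‖a‖ :=
  NonUnitalStarAlgHom.norm_apply_le φ.rep a

theorem norm_gnsMap_le (φ : CStarState A) (a : A) : ‖φ.gnsMap a‖ ≤ ‖a‖ := by
  have h : ‖φ.gnsMap a‖ ^ 2 ≤ ‖a‖ ^ 2 := by
    have hin : ‖φ.gnsMap a‖ ^ 2 = ‖φ (star a * a)‖ := by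
      rw [← inner_gnsMap, inner_self_eq_norm_sq_to_K]; simp
    rw [hin]
    refine (φ.toCLM.le_opNorm _).trans ?_
    rw [φ.norm_eq_one, one_mul, CStarRing.norm_star_mul_self, sq]
  exact (pow_le_pow_iff_left₀ (norm_nonneg _) (norm_nonneg _) two_ne_zero).1 h

/-- States are normalized by `‖φ‖ = 1`. Since `φ a = ⟨Ω, aΩ⟩` and `‖aΩ‖ ≤ ‖a‖`, this forces `‖Ω‖ =
1`. -/
theorem apply_one (φ : CStarState A) : φ 1 = 1 := by
  have hnt : Nontrivial A := by
    refine not_subsingleton_iff_nontrivial.1 fun _ => ?_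
    have h := φ.norm_eq_one
    rw [Subsingleton.elim φ.toCLM 0] at h
    simp at h
  have hle : ‖φ.gnsMap 1‖ ≤ 1 := (φ.norm_gnsMap_le 1).trans_eq CStarRing.norm_one
  have hge : 1 ≤ ‖φ.gnsMap 1‖ := by
    rw [← φ.norm_eq_one]
    refine φ.toCLM.opNorm_le_bound (norm_nonneg _) fun a => ?_
    have h := φ.inner_gnsMap 1 a
    rw [star_one, one_mul] at h
    rw [← h]
    exact (norm_inner_le_norm _ _).trans
      (mul_le_mul_of_nonneg_left (φ.norm_gnsMap_le a) (norm_nonneg _))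
  have h := φ.inner_gnsMap 1 1
  rw [inner_self_eq_norm_sq_to_K, le_antisymm hle hge] at h
  simpa using h.symm

theorem inner_rep_right (φ : CStarState A) (a : A) (ξ η : φ.toPositive.GNS) :
    inner ℂ ξ (φ.rep a η) = inner ℂ (φ.rep (star a) ξ) η := by
  rw [map_star, ContinuousLinearMap.star_eq_adjoint, ContinuousLinearMap.adjoint_inner_left]

/-- The GNS representation of a state generates a factor iff every operator in the commutant and
the bicommutant of its range is a scalar. -/
theorem isFactorState_iff (φ : CStarState A) : φ.IsFactorState ↔
    ∀ z : φ.toPositive.GNS →L[ℂ] φ.toPositive.GNS, (∀ a, Commute (φ.rep a) z) →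
      (∀ T, (∀ a, Commute (φ.rep a) T) → Commute T z) → ∃ c : ℂ, z = c • 1 := by
  have hcomm : ∀ T, T ∈ StarSubalgebra.centralizer ℂ (Set.range φ.rep) ↔
      ∀ a, Commute (φ.rep a) T := by
    intro T
    rw [StarSubalgebra.mem_centralizer_iff]
    constructor
    · exact fun h a => (h _ ⟨a, rfl⟩).1
    · rintro h _ ⟨a, rfl⟩
      exact ⟨h a, by rw [← map_star]; exact h _⟩
  have hmem : ∀ z, z ∈ φ.gnsVonNeumann ↔
      ∀ T, (∀ a, Commute (φ.rep a) T) → Commute T z := by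
    intro z
    change z ∈ StarSubalgebra.centralizer ℂ
      (StarSubalgebra.centralizer ℂ (Set.range φ.rep) : Set _) ↔ _
    rw [StarSubalgebra.mem_centralizer_iff]
    constructor
    · exact fun h T hT => (h T ((hcomm T).2 hT)).1
    · exact fun h T hT => ⟨h T ((hcomm T).1 hT), h _ ((hcomm _).1 (star_mem hT))⟩
  have hrep : ∀ a, φ.rep a ∈ φ.gnsVonNeumann := fun a => (hmem _).2 fun T hT => (hT a).symm
  constructor
  · intro h z hz hz'
    refine h z ((hmem z).2 hz') (VonNeumannAlgebra.mem_commutant_iff.2 fun g hg => ?_)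
    exact ((hmem g).1 hg z hz).symm
  · intro h z hz hz'
    exact h z (fun a => VonNeumannAlgebra.mem_commutant_iff.1 hz' _ (hrep a)) ((hmem z).1 hz)

/-! ### Clustering of factor states -/

/-- A factor state clusters uniformly over the unit ball of a finite dimensional local algebra. -/
theorem IsFactorState.exists_finset_norm_correlation_lt {X : Type*} {φ : CStarState A}
    (hφ : φ.IsFactorState) {N : DiscreteNet X A} (hN : N.LocallyFiniteDimensional)
    (F : Finset X) {ε : ℝ} (hε : 0 < ε) :
    ∃ G : Finset X, ∀ a ∈ N.loc F, ∀ b ∈ N.region (G : Set X)ᶜ, ‖a‖ ≤ 1 → ‖b‖ ≤ 1 →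
      ‖φ (a * b) - φ a * φ b‖ < ε := by
  classical
  by_contra! hcon
  choose a ha b hb ha1 hb1 hab using hcon
  -- An ultrafilter finer than `atTop` gives limits of all bounded data at once while every fixed
  -- finite region is eventually contained in `G`.
  let 𝒰 : Ultrafilter (Finset X) := Ultrafilter.of Filter.atTop
  have h𝒰 : (𝒰 : Filter (Finset X)) ≤ Filter.atTop := Ultrafilter.of_le _
  obtain ⟨z, hz⟩ := exists_weak_limit_of_norm_le_one 𝒰 (fun G => φ.rep (b G))
    fun G => (φ.norm_rep_le _).trans (hb1 G)
  obtain ⟨a₀, ha₀⟩ : ∃ a₀ : A, Filter.Tendsto a 𝒰 (𝓝 a₀) := by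
    have := hN F
    have : ProperSpace (N.loc F) := FiniteDimensional.proper ℂ (N.loc F)
    obtain ⟨x, -, hx⟩ := (isCompact_closedBall (0 : N.loc F) 1).ultrafilter_le_nhds'
      (𝒰.map fun G => (⟨a G, ha G⟩ : N.loc F))
      (Filter.mem_map.2 (Filter.Eventually.of_forall fun G => by simpa using ha1 G))
    exact ⟨x, (continuous_subtype_val.tendsto x).comp hx⟩
  -- For local `c` the operators commute as soon as `G` contains the support of `c`; density and
  -- norm continuity cover the rest.
  have hcomm : ∀ c, Commute (φ.rep c) z := by
    have hcont : Continuous φ.rep := map_continuous φ.rep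
    have hclosed : IsClosed {c | φ.rep c * z = z * φ.rep c} :=
      isClosed_eq (hcont.mul continuous_const) (continuous_const.mul hcont)
    intro c
    refine hclosed.closure_subset_iff.2 ?_ (N.dense c)
    refine Set.iUnion_subset fun G c hc => commute_of_tendsto_inner hz ?_
    filter_upwards [h𝒰 (Filter.eventually_ge_atTop G)] with K hK
    exact Commute.map (N.commute_loc_region_compl K (N.mono hK hc) (hb K)) φ.rep
  obtain ⟨s, hs⟩ := (isFactorState_iff φ).1 hφ z hcomm fun T hT =>
    commute_of_tendsto_inner hz (Filter.Eventually.of_forall fun G => (hT (b G)).symm)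
  have hb_lim : ∀ c, Filter.Tendsto (fun G => φ (c * b G)) 𝒰 (𝓝 (s * φ c)) := by
    intro c
    have h := hz (φ.gnsMap (star c)) (φ.gnsMap 1)
    simp only [rep_gnsMap, inner_gnsMap, hs, smul_apply,
      one_apply_eq_self, inner_smul_right, star_star, mul_one] at h
    exact h
  have hone : Filter.Tendsto (fun G => φ (b G)) 𝒰 (𝓝 s) := by
    simpa [φ.apply_one] using hb_lim 1
  -- Weak convergence of `b G` handles only a fixed left factor; norm convergence of `a G` allows it
  -- to be replaced by `a₀`.
  have hdiff : Filter.Tendsto (fun G => φ ((a G - a₀) * b G)) 𝒰 (𝓝 0) := by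
    refine squeeze_zero_norm (a := fun G => ‖a G - a₀‖) (fun G => ?_)
      (tendsto_iff_norm_sub_tendsto_zero.1 ha₀)
    refine (φ.toCLM.le_opNorm _).trans ?_
    rw [φ.norm_eq_one, one_mul]
    exact (norm_mul_le _ _).trans (mul_le_of_le_one_right (norm_nonneg _) (hb1 G))
  have hlim : Filter.Tendsto (fun G => ‖φ (a G * b G) - φ (a G) * φ (b G)‖) 𝒰 (𝓝 0) := by
    have h := ((hdiff.add (hb_lim a₀)).sub
      (((φ.toCLM.continuous.tendsto a₀).comp ha₀).mul hone)).norm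
    have h0 : ‖0 + s * φ a₀ - φ a₀ * s‖ = 0 := by rw [zero_add, mul_comm, sub_self, norm_zero]
    rw [h0] at h
    refine h.congr fun G => ?_
    rw [sub_mul, map_sub, sub_add_cancel]
    rfl
  exact hε.not_ge (ge_of_tendsto' hlim hab)

/-- A translation invariant factor state only correlates regions at bounded distance. -/
theorem IsFactorState.higherCorrelationCoarse_subset {Γ : Type*} [Group Γ] {S : Set Γ}
    (hfin : S.Finite) (hS : Subgroup.closure S = ⊤) {N : DiscreteNet Γ A}
    (hN : N.LocallyFiniteDimensional) {ρ : Γ →* (A ≃⋆ₐ[ℂ] A)} (hρ : N.IsCovariant ρ)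
    {φ : CStarState A} (hφ : φ.IsFactorState) (hinv : φ.IsInvariant ρ) :
    (φ.higherCorrelationCoarse N).controlled ⊆
      (CoarseStructure.ofGraph (cayleyGraph S)).controlled := by
  classical
  refine CoarseStructure.ofHigherFunction_subset fun E hE ε hε => ?_
  rw [mem_ofGraph_cayleyGraph_iff hfin hS] at hE ⊢
  obtain ⟨K, hK⟩ := hE
  -- The supremum turns strict bounds into non-strict ones, so `ε / 2` is used to remain strictly
  -- below the superlevel `ε`.
  obtain ⟨G, hG⟩ := hφ.exists_finset_norm_correlation_lt hN K (half_pos (NNReal.coe_pos.2 hε))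
  refine ⟨(K ×ˢ G).image fun p => p.1⁻¹ * p.2, ?_⟩
  rintro ⟨x, y⟩ hxy
  by_contra hnot
  have hx : (fun g => g * x⁻¹) '' CoarseStructure.ball E x ⊆ (K : Set Γ) := by
    rintro _ ⟨g, hg, rfl⟩
    exact hK (x, g) hg
  have hy : (fun g => g * x⁻¹) '' CoarseStructure.ball E y ⊆ (G : Set Γ)ᶜ := by
    rintro _ ⟨g, hg, rfl⟩ hgG
    refine hnot (Finset.mem_image.2 ⟨(g * y⁻¹, g * x⁻¹),
      Finset.mem_product.2 ⟨hK (y, g) hg, hgG⟩, ?_⟩)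
    simp
  have hle : φ.higherCorrelation N (CoarseStructure.ball E x) (CoarseStructure.ball E y) ≤
      ((ε / 2 : ℝ≥0) : ℝ≥0∞) := by
    refine (hinv.higherCorrelation_le hρ x _ _).trans
      ((φ.higherCorrelation_mono N hx hy).trans ?_)
    refine iSup₂_le fun a ha => iSup₂_le fun b hb => iSup₂_le fun ha1 hb1 => ?_
    have h := hG a (N.region_coe_le_loc K ha) b hb ha1 hb1
    rw [enorm_eq_nnnorm, ENNReal.coe_le_coe, ← NNReal.coe_le_coe]
    exact h.le
  have hlt : ((ε / 2 : ℝ≥0) : ℝ≥0∞) < ε := ENNReal.coe_lt_coe.2 (NNReal.half_lt_self hε.ne')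
  exact (lt_of_le_of_lt hle hlt).not_ge hxy

end CStarState
end

/-! ### Generators of time evolutions -/

noncomputable section

namespace TimeEvolution

variable {A : Type*} [CStarAlgebra A] (α : TimeEvolution A)

/-- The automorphism `α_t`. -/
def act (t : ℝ) : A ≃⋆ₐ[ℂ] A := α.toHom (Multiplicative.ofAdd t)

theorem act_zero (a : A) : α.act 0 a = a := by
  simp [act]

theorem act_add (s t : ℝ) (a : A) : α.act (s + t) a = α.act s (α.act t a) := by
  simp [act, ofAdd_add]

theorem act_act_neg (t : ℝ) (a : A) : α.act t (α.act (-t) a) = a := by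
  rw [← act_add, add_neg_cancel, act_zero]

theorem continuous_act (a : A) : Continuous fun t => α.act t a := α.continuous_apply a

theorem continuous_act_right (t : ℝ) : Continuous (α.act t) :=
  (StarAlgEquiv.isometry (α.act t)).continuous

/-- `d` is the derivative of `t ↦ α_t(a)` at `0`, that is, `a` is in the domain of the generator
and is mapped to `d`. -/
def HasGenerator (a d : A) : Prop := HasDerivAt (fun t => α.act t a) d 0

variable {α}

theorem HasGenerator.add {a b d e : A} (ha : α.HasGenerator a d) (hb : α.HasGenerator b e) :
    α.HasGenerator (a + b) (d + e) := by
  simpa only [HasGenerator, map_add] using HasDerivAt.fun_add ha hb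

theorem HasGenerator.smul {a d : A} (c : ℂ) (ha : α.HasGenerator a d) :
    α.HasGenerator (c • a) (c • d) := by
  simpa only [HasGenerator, map_smul] using HasDerivAt.fun_const_smul c ha

theorem HasGenerator.mul {a b d e : A} (ha : α.HasGenerator a d) (hb : α.HasGenerator b e) :
    α.HasGenerator (a * b) (d * b + a * e) := by
  simpa only [HasGenerator, map_mul, act_zero] using HasDerivAt.fun_mul ha hb

variable (α)

theorem hasGenerator_one : α.HasGenerator 1 0 := by
  simpa only [HasGenerator, map_one] using hasDerivAt_const (0 : ℝ) (1 : A)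

theorem hasGenerator_generator (a : α.generator.domain) :
    α.HasGenerator (a : A) (α.generator a) :=
  DifferentiableAt.hasDerivAt a.2

variable {α} in
theorem HasGenerator.exists_generator_eq {a d : A} (h : α.HasGenerator a d) :
    ∃ ha : a ∈ α.generator.domain, α.generator ⟨a, ha⟩ = d :=
  ⟨HasDerivAt.differentiableAt h, HasDerivAt.deriv h⟩

/-- The integral `∫₀ᵀ α_t(b) dt` of an orbit. -/
def orbitIntegral (b : A) (T : ℝ) : A := ∫ t in (0 : ℝ)..T, α.act t b

theorem hasDerivAt_orbitIntegral (b : A) (T : ℝ) :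
    HasDerivAt (α.orbitIntegral b) (α.act T b) T :=
  intervalIntegral.integral_hasDerivAt_right ((α.continuous_act b).intervalIntegrable _ _)
    ((α.continuous_act b).stronglyMeasurableAtFilter _ _) (α.continuous_act b).continuousAt

theorem map_orbitIntegral {E : Type*} [NormedAddCommGroup E] [NormedSpace ℂ E] [CompleteSpace E]
    (L : A →L[ℂ] E) (b : A) (T : ℝ) :
    L (α.orbitIntegral b T) = ∫ t in (0 : ℝ)..T, L (α.act t b) :=
  (L.intervalIntegral_comp_comm ((α.continuous_act b).intervalIntegrable _ _)).symm

theorem act_orbitIntegral (s : ℝ) (b : A) (T : ℝ) :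
    α.act s (α.orbitIntegral b T) = α.orbitIntegral b (s + T) - α.orbitIntegral b s := by
  let L : A →L[ℂ] A := ⟨(α.act s : A ≃⋆ₐ[ℂ] A).toAlgEquiv.toLinearMap, α.continuous_act_right s⟩
  have h := α.map_orbitIntegral L b T
  have hL : ∀ a, L a = α.act s a := fun a => rfl
  simp only [hL, ← act_add] at h
  rw [h, intervalIntegral.integral_comp_add_left (fun t => α.act t b), add_zero]
  exact (intervalIntegral.integral_interval_sub_left
    ((α.continuous_act b).intervalIntegrable _ _) ((α.continuous_act b).intervalIntegrable _ _)).symm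

/-- Orbit integrals are in the domain of the generator. -/
theorem hasGenerator_orbitIntegral (b : A) (T : ℝ) :
    α.HasGenerator (α.orbitIntegral b T) (α.act T b - b) := by
  have h₁ : HasDerivAt (fun s => α.orbitIntegral b (s + T)) (α.act T b) 0 := by
    refine HasDerivAt.comp_add_const 0 T ?_
    rw [zero_add]
    exact α.hasDerivAt_orbitIntegral b T
  have h₂ := α.hasDerivAt_orbitIntegral b 0
  rw [act_zero] at h₂
  simpa only [HasGenerator, act_orbitIntegral] using h₁.fun_sub h₂

/-- A continuous functional vanishing on the domain of the generator is zero. -/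
theorem eq_zero_of_forall_hasGenerator (L : A →L[ℂ] ℂ)
    (h : ∀ c d, α.HasGenerator c d → L c = 0) (c : A) : L c = 0 := by
  have h₁ := (L.restrictScalars ℝ).hasFDerivAt.comp_hasDerivAt 0 (α.hasDerivAt_orbitIntegral c 0)
  have h₂ : (L.restrictScalars ℝ) ∘ (α.orbitIntegral c) = fun _ => 0 :=
    funext fun T => h _ _ (α.hasGenerator_orbitIntegral c T)
  rw [h₂, act_zero] at h₁
  exact h₁.unique (hasDerivAt_const _ _)

end TimeEvolution

/-! ### Ground states -/

/-- A positive sesquilinear form on a two dimensional space satisfies the Cauchy–Schwarz inequality. -/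
theorem norm_sq_le_of_forall_nonneg {p q r s : ℂ}
    (h : ∀ c : ℂ, 0 ≤ p + c * r + (starRingEnd ℂ) c * s + (starRingEnd ℂ) c * c * q)
    (hq : 0 ≤ q) : ‖r‖ ^ 2 ≤ p.re * q.re := by
  have him : ∀ c : ℂ, _ := fun c => (Complex.le_def.1 (h c)).2
  have hre : ∀ c : ℂ, _ := fun c => (Complex.le_def.1 (h c)).1
  have hq2 := (Complex.le_def.1 hq).2
  have h0 := him 0
  have h1 := him 1
  have hI := him Complex.I
  simp at hq2 h0 h1 hI
  -- Reality of the form at `c = 0, 1, i` makes it Hermitian.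
  have hs : (starRingEnd ℂ) r = s := by
    apply Complex.ext <;> simp <;> linarith
  have hdisc : discrim (‖r‖ ^ 2 * q.re) (-2 * ‖r‖ ^ 2) p.re ≤ 0 := by
    refine discrim_le_zero fun t => ?_
    -- This choice of `c` aligns the phase of the cross term, leaving `p - 2t‖r‖² + t²‖r‖²q ≥ 0` for
    -- all real `t`. The discriminant bound then carries a spare factor `‖r‖²`, cancelled at the
    -- end.
    have ht := hre (-(t : ℂ) * (starRingEnd ℂ) r)
    rw [← hs] at ht
    rw [← Complex.normSq_eq_norm_sq, Complex.normSq_apply]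
    simp at ht
    nlinarith [ht]
  have hp := hre 0
  simp at hp
  have hq1 := (Complex.le_def.1 hq).1
  simp at hq1
  rw [discrim] at hdisc
  by_cases hr : ‖r‖ ^ 2 = 0
  · rw [hr]; positivity
  · have hr' : 0 < ‖r‖ ^ 2 := lt_of_le_of_ne (by positivity) (Ne.symm hr)
    nlinarith

namespace CStarState

variable {A : Type*} [CStarAlgebra A]

theorem isGroundState_generator_iff {φ : CStarState A} {α : TimeEvolution A} :
    φ.IsGroundState α.generator ↔
      ∀ a d, α.HasGenerator a d → 0 ≤ -Complex.I * φ (star a * d) := by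
  constructor
  · intro h a d hd
    obtain ⟨ha, rfl⟩ := hd.exists_generator_eq
    exact h ⟨a, ha⟩
  · exact fun h a => h a _ (α.hasGenerator_generator a)

namespace IsGroundState

variable {φ : CStarState A} {α : TimeEvolution A} (hφ : φ.IsGroundState α.generator)

include hφ

/-- The Cauchy–Schwarz inequality for the energy form `(a, b) ↦ -i φ(a* δ(b))`. -/
theorem norm_sq_le {a b d e : A} (ha : α.HasGenerator a d)
    (hb : α.HasGenerator b e) :
    ‖φ (star a * e)‖ ^ 2 ≤
      (-Complex.I * φ (star a * d)).re * (-Complex.I * φ (star b * e)).re := by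
  rw [isGroundState_generator_iff] at hφ
  have h := norm_sq_le_of_forall_nonneg (p := -Complex.I * φ (star a * d))
    (q := -Complex.I * φ (star b * e)) (r := -Complex.I * φ (star a * e))
    (s := -Complex.I * φ (star b * d)) (fun c => ?_) (hφ b e hb)
  · simpa only [norm_mul, norm_neg, Complex.norm_I, one_mul] using h
  · refine (hφ _ _ (ha.add (hb.smul c))).trans_eq ?_
    simp only [star_add, star_smul, add_mul, mul_add, smul_mul_assoc, mul_smul_comm, map_add,
      map_smul, smul_eq_mul, Complex.star_def]
    ring

/-- Ground states are invariant under the time evolution. -/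
theorem apply_act (t : ℝ) (a : A) : φ (α.act t a) = φ a := by
  -- Since `δ(1) = 0`, the energy of `1` vanishes, so `φ` kills the range of `δ`, in particular
  -- `α_t(a) - a`.
  have h := hφ.norm_sq_le α.hasGenerator_one (α.hasGenerator_orbitIntegral a t)
  simp only [star_one, one_mul, map_sub, map_zero, mul_zero, Complex.zero_re, zero_mul] at h
  have h0 : ‖φ (α.act t a) - φ a‖ = 0 := by nlinarith [norm_nonneg (φ (α.act t a) - φ a)]
  exact sub_eq_zero.1 (norm_eq_zero.1 h0)

end IsGroundState

end CStarState
end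

/-! ### Vector states and implementing unitaries on the GNS space -/

noncomputable section

namespace CStarState

variable {A : Type*} [CStarAlgebra A] [PartialOrder A] [StarOrderedRing A]

/-- The map `a ↦ π_φ(a) Ω_φ` as a continuous linear map. -/
def gnsCLM (φ : CStarState A) : A →L[ℂ] φ.toPositive.GNS :=
  φ.gnsMap.mkContinuous 1 fun a => by simpa using φ.norm_gnsMap_le a

theorem gnsCLM_apply (φ : CStarState A) (a : A) : φ.gnsCLM a = φ.gnsMap a := rfl

/-- An operator commuting with the representation is determined by its value at the cyclic
vector. -/
theorem eq_of_commute_of_apply_eq (φ : CStarState A)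
    {v w : φ.toPositive.GNS →L[ℂ] φ.toPositive.GNS} (hv : ∀ a, Commute (φ.rep a) v)
    (hw : ∀ a, Commute (φ.rep a) w) (h : v (φ.gnsMap 1) = w (φ.gnsMap 1)) : v = w := by
  refine ContinuousLinearMap.coeFn_injective
    (φ.denseRange_gnsMap.equalizer v.continuous w.continuous (funext fun a => ?_))
  have key : ∀ u : φ.toPositive.GNS →L[ℂ] φ.toPositive.GNS, (∀ a, Commute (φ.rep a) u) →
      u (φ.gnsMap a) = φ.rep a (u (φ.gnsMap 1)) := by
    intro u hu
    have h1 := congrArg (fun R : φ.toPositive.GNS →L[ℂ] φ.toPositive.GNS => R (φ.gnsMap 1))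
      (hu a).eq
    simp only [mul_apply_eq_comp, rep_gnsMap, mul_one] at h1
    exact h1.symm
  rw [Function.comp_apply, Function.comp_apply, key v hv, key w hw, h]

theorem eq_zero_of_inner_gnsMap_eq_zero (φ : CStarState A) {ξ : φ.toPositive.GNS}
    (h : ∀ a, inner ℂ ξ (φ.gnsMap a) = 0) : ξ = 0 := by
  have hz : (fun η => inner ℂ ξ η) = fun _ => (0 : ℂ) :=
    φ.denseRange_gnsMap.equalizer (by fun_prop) continuous_const (funext h)
  exact inner_self_eq_zero.1 (congrFun hz ξ)

/-- The state `a ↦ ⟨ω, π_φ(a) ω⟩ / ‖ω‖²` of a nonzero vector of the GNS space. -/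
def ofVector (φ : CStarState A) (ω : φ.toPositive.GNS) (hω : ω ≠ 0) : CStarState A :=
  have hpos : 0 < ‖ω‖ ^ 2 := by positivity
  have hbound : ∀ a : A, ‖((‖ω‖ ^ 2)⁻¹ : ℝ) • inner ℂ ω (φ.rep a ω)‖ ≤ 1 * ‖a‖ := fun a => by
    have h : ‖inner ℂ ω (φ.rep a ω)‖ ≤ ‖ω‖ ^ 2 * ‖a‖ := by
      refine (norm_inner_le_norm _ _).trans ?_
      refine (mul_le_mul_of_nonneg_left (((φ.rep a).le_opNorm ω).trans
        (mul_le_mul_of_nonneg_right (φ.norm_rep_le a) (norm_nonneg _))) (norm_nonneg _)).trans_eq ?_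
      ring
    rw [norm_smul, norm_inv, Real.norm_of_nonneg hpos.le, inv_mul_le_iff₀ hpos, one_mul]
    exact h
  { toCLM := LinearMap.mkContinuous
      { toFun := fun a => ((‖ω‖ ^ 2)⁻¹ : ℝ) • inner ℂ ω (φ.rep a ω)
        map_add' := fun a b => by simp only [map_add, add_apply, inner_add_right, smul_add]
        map_smul' := fun c a => by
          simp only [map_smul, smul_apply, inner_smul_right, RingHom.id_apply, smul_eq_mul]
          rw [mul_smul_comm] } 1 hbound
    norm_eq_one := by
      refine le_antisymm (LinearMap.mkContinuous_norm_le _ zero_le_one _) ?_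
      refine le_trans ?_ (ContinuousLinearMap.unit_le_opNorm _ (1 : A) ?_)
      · simp only [LinearMap.mkContinuous_apply, LinearMap.coe_mk, AddHom.coe_mk, map_one,
          one_apply_eq_self, inner_self_eq_norm_sq_to_K, norm_smul]
        simp [hω]
      · exact (CStarAlgebra.norm_le_one_iff_of_nonneg (1 : A) zero_le_one).2 le_rfl
    nonneg := fun a => by
      simp only [LinearMap.mkContinuous_apply, LinearMap.coe_mk, AddHom.coe_mk, map_mul,
        mul_apply_eq_comp, map_star, ContinuousLinearMap.star_eq_adjoint,
        ContinuousLinearMap.adjoint_inner_right]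
      refine smul_nonneg (inv_nonneg.2 hpos.le) ?_
      rw [inner_self_eq_norm_sq_to_K, ← RCLike.ofReal_pow]
      exact RCLike.ofReal_nonneg.2 (sq_nonneg _) }

theorem ofVector_apply (φ : CStarState A) (ω : φ.toPositive.GNS) (hω : ω ≠ 0) (a : A) :
    φ.ofVector ω hω a = ((‖ω‖ ^ 2)⁻¹ : ℝ) • inner ℂ ω (φ.rep a ω) := rfl

/-- The unitary implementing `α_t` in the GNS representation of an invariant state. -/
def implementer (φ : CStarState A) (α : TimeEvolution A) (t : ℝ) :
    φ.toPositive.GNS →L[ℂ] φ.toPositive.GNS :=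
  LinearMap.extendOfNorm (φ.gnsMap ∘ₗ (α.act t).toAlgEquiv.toLinearMap) φ.gnsMap

section Implementer

variable {φ : CStarState A} {α : TimeEvolution A} (hinv : ∀ t a, φ (α.act t a) = φ a)

include hinv

theorem implementer_gnsMap (t : ℝ) (a : A) :
    φ.implementer α t (φ.gnsMap a) = φ.gnsMap (α.act t a) := by
  refine LinearMap.extendOfNorm_eq φ.denseRange_gnsMap ⟨1, fun x => ?_⟩ a
  rw [one_mul]
  refine (pow_le_pow_iff_left₀ (norm_nonneg _) (norm_nonneg _) two_ne_zero).1 (le_of_eq ?_)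
  have h : inner ℂ (φ.gnsMap (α.act t x)) (φ.gnsMap (α.act t x)) =
      inner ℂ (φ.gnsMap x) (φ.gnsMap x) := by
    rw [inner_gnsMap, inner_gnsMap, ← map_star, ← map_mul, hinv]
  rw [inner_self_eq_norm_sq_to_K, inner_self_eq_norm_sq_to_K] at h
  exact_mod_cast h

theorem inner_implementer (t : ℝ) (ξ η : φ.toPositive.GNS) :
    inner ℂ (φ.implementer α t ξ) (φ.implementer α t η) = inner ℂ ξ η := by
  refine φ.denseRange_gnsMap.induction_on₂
    (p := fun ξ η => inner ℂ (φ.implementer α t ξ) (φ.implementer α t η) = inner ℂ ξ η)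
    (isClosed_eq (by fun_prop) (by fun_prop)) (fun a b => ?_) ξ η
  rw [implementer_gnsMap hinv, implementer_gnsMap hinv, inner_gnsMap, inner_gnsMap, ← map_star,
    ← map_mul, hinv]

theorem norm_implementer (t : ℝ) (ξ : φ.toPositive.GNS) : ‖φ.implementer α t ξ‖ = ‖ξ‖ := by
  rw [norm_eq_sqrt_re_inner (𝕜 := ℂ), norm_eq_sqrt_re_inner (𝕜 := ℂ) ξ, inner_implementer hinv]

theorem implementer_implementer_neg (t : ℝ) (ξ : φ.toPositive.GNS) :
    φ.implementer α t (φ.implementer α (-t) ξ) = ξ := by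
  refine φ.denseRange_gnsMap.induction_on
    (p := fun ξ => φ.implementer α t (φ.implementer α (-t) ξ) = ξ) ξ
    (isClosed_eq (by fun_prop) (by fun_prop)) (fun a => ?_)
  rw [implementer_gnsMap hinv, implementer_gnsMap hinv, α.act_act_neg]

theorem rep_implementer (t : ℝ) (a : A) (ξ : φ.toPositive.GNS) :
    φ.rep a (φ.implementer α t ξ) = φ.implementer α t (φ.rep (α.act (-t) a) ξ) := by
  refine φ.denseRange_gnsMap.induction_on
    (p := fun ξ => φ.rep a (φ.implementer α t ξ) = φ.implementer α t (φ.rep (α.act (-t) a) ξ)) ξ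
    (isClosed_eq (by fun_prop) (by fun_prop)) (fun b => ?_)
  rw [implementer_gnsMap hinv, rep_gnsMap, rep_gnsMap, implementer_gnsMap hinv, map_mul (α.act t),
    α.act_act_neg]

theorem implementer_gnsMap_one (t : ℝ) :
    φ.implementer α t (φ.gnsMap 1) = φ.gnsMap 1 := by
  rw [implementer_gnsMap hinv, map_one]

/-- For a self-adjoint central operator `w`, the numbers `⟨wΩ, U_t wΩ⟩` are real. -/
theorem inner_implementer_comm_of_central {w : φ.toPositive.GNS →L[ℂ] φ.toPositive.GNS}
    (hsa : IsSelfAdjoint w) (hw : ∀ a, Commute (φ.rep a) w)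
    (hw' : ∀ T, (∀ a, Commute (φ.rep a) T) → Commute T w) (t : ℝ) :
    inner ℂ (φ.implementer α t (w (φ.gnsMap 1))) (w (φ.gnsMap 1)) =
      inner ℂ (w (φ.gnsMap 1)) (φ.implementer α t (w (φ.gnsMap 1))) := by
  have hadj : ∀ ξ η, inner ℂ (w ξ) η = inner ℂ ξ (w η) := fun ξ η => by
    rw [← ContinuousLinearMap.adjoint_inner_left, ← ContinuousLinearMap.star_eq_adjoint, hsa.star_eq]
  have hrw : ∀ a ξ, φ.rep a (w ξ) = w (φ.rep a ξ) := fun a ξ =>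
    congrArg (fun R : φ.toPositive.GNS →L[ℂ] φ.toPositive.GNS => R ξ) (hw a).eq
  -- The conjugate `v = U_t w U_t⁻¹` is again in the commutant, hence commutes with the central `w`,
  -- and `vΩ = U_t wΩ`.
  let v := φ.implementer α t * w * φ.implementer α (-t)
  have hv_apply : ∀ ξ, v ξ = φ.implementer α t (w (φ.implementer α (-t) ξ)) := fun ξ => rfl
  have hv : ∀ a, Commute (φ.rep a) v := fun a => by
    refine ContinuousLinearMap.ext fun ξ => ?_
    change φ.rep a (v ξ) = v (φ.rep a ξ)
    rw [hv_apply, hv_apply, rep_implementer hinv, hrw, rep_implementer hinv, neg_neg,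
      α.act_act_neg]
  have hvw : ∀ ξ, v (w ξ) = w (v ξ) := fun ξ =>
    congrArg (fun R : φ.toPositive.GNS →L[ℂ] φ.toPositive.GNS => R ξ) (hw' v hv).eq
  have hvΩ : v (φ.gnsMap 1) = φ.implementer α t (w (φ.gnsMap 1)) := by
    rw [hv_apply, implementer_gnsMap_one hinv]
  calc inner ℂ (φ.implementer α t (w (φ.gnsMap 1))) (w (φ.gnsMap 1))
      = inner ℂ (v (w (φ.gnsMap 1))) (φ.gnsMap 1) := by rw [← hvΩ, ← hadj, hvw]
    _ = inner ℂ (φ.implementer α t (w (φ.implementer α (-t) (w (φ.gnsMap 1)))))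
          (φ.implementer α t (φ.gnsMap 1)) := by rw [hv_apply, implementer_gnsMap_one hinv]
    _ = inner ℂ (φ.implementer α (-t) (w (φ.gnsMap 1))) (w (φ.gnsMap 1)) := by
      rw [inner_implementer hinv, hadj]
    _ = inner ℂ (w (φ.gnsMap 1)) (φ.implementer α t (w (φ.gnsMap 1))) := by
      rw [← inner_implementer hinv t, implementer_implementer_neg hinv]

end Implementer

end CStarState
end

/-! ### Central vectors of a ground state and the factor property -/

noncomputable section

namespace CStarState

variable {A : Type*} [CStarAlgebra A] [PartialOrder A] [StarOrderedRing A]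

/-- The energy of an orbit integral, in terms of the imaginary part of `⟨ξ, U_t ξ⟩`. -/
theorem conj_apply_star_orbitIntegral_mul {φ : CStarState A} {α : TimeEvolution A}
    (hinv : ∀ t a, φ (α.act t a) = φ a) (b : A) (T : ℝ) :
    (starRingEnd ℂ) (φ (star (α.orbitIntegral b T) * (α.act T b - b))) =
      ∫ t in (0 : ℝ)..T, (inner ℂ (φ.implementer α t (φ.gnsMap b)) (φ.gnsMap b) -
        inner ℂ (φ.gnsMap b) (φ.implementer α t (φ.gnsMap b))) := by
  have hcont : Continuous fun t => φ.gnsMap (α.act t b) :=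
    φ.gnsCLM.continuous.comp (α.continuous_act b)
  -- By invariance only `T - t` matters, so reflecting the interval removes `T` from the integrand.
  have hT : ∀ t, inner ℂ (φ.gnsMap (α.act T b)) (φ.gnsMap (α.act t b)) =
      inner ℂ (φ.gnsMap (α.act (T - t) b)) (φ.gnsMap b) := fun t => by
    rw [← inner_implementer hinv t (φ.gnsMap (α.act (T - t) b)), implementer_gnsMap hinv,
      implementer_gnsMap hinv, ← α.act_add, add_sub_cancel]
  have hstar : (starRingEnd ℂ) (φ (star (α.orbitIntegral b T) * (α.act T b - b))) =
      inner ℂ (φ.gnsMap (α.act T b) - φ.gnsMap b) (φ.gnsMap (α.orbitIntegral b T)) := by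
    rw [← inner_gnsMap, inner_conj_symm, map_sub]
  have hint : inner ℂ (φ.gnsMap (α.act T b) - φ.gnsMap b) (φ.gnsMap (α.orbitIntegral b T)) =
      ∫ t in (0 : ℝ)..T, (inner ℂ (φ.gnsMap (α.act t b)) (φ.gnsMap b) -
        inner ℂ (φ.gnsMap b) (φ.gnsMap (α.act t b))) := by
    have h := α.map_orbitIntegral
      ((innerSL ℂ (φ.gnsMap (α.act T b) - φ.gnsMap b)).comp φ.gnsCLM) b T
    simp only [ContinuousLinearMap.comp_apply, gnsCLM_apply, innerSL_apply_apply, inner_sub_left,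
      hT] at h
    rw [inner_sub_left, h, intervalIntegral.integral_sub, intervalIntegral.integral_sub,
      intervalIntegral.integral_comp_sub_left
        (fun t => inner ℂ (φ.gnsMap (α.act t b)) (φ.gnsMap b)), sub_self, sub_zero]
    · exact Continuous.intervalIntegrable (by fun_prop) _ _
    · exact Continuous.intervalIntegrable (by fun_prop) _ _
    · refine Continuous.intervalIntegrable ?_ _ _
      exact (hcont.comp (continuous_const.sub continuous_id)).inner continuous_const
    · exact Continuous.intervalIntegrable (by fun_prop) _ _
  rw [hstar, hint]
  simp only [implementer_gnsMap hinv]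

namespace IsGroundState

variable {φ : CStarState A} {α : TimeEvolution A} (hφ : φ.IsGroundState α.generator)

include hφ

/-- The time evolution fixes `wΩ` for every self-adjoint central operator `w`. -/
theorem implementer_apply_of_central {w : φ.toPositive.GNS →L[ℂ] φ.toPositive.GNS}
    (hsa : IsSelfAdjoint w) (hw : ∀ a, Commute (φ.rep a) w)
    (hw' : ∀ T, (∀ a, Commute (φ.rep a) T) → Commute T w) (T : ℝ) :
    φ.implementer α T (w (φ.gnsMap 1)) = w (φ.gnsMap 1) := by
  have hinv := hφ.apply_act
  have hreal := fun t => inner_implementer_comm_of_central hinv hsa hw hw' t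
  set ω := w (φ.gnsMap 1)
  obtain ⟨x, hx, hxω⟩ := mem_closure_iff_seq_limit.1 (φ.denseRange_gnsMap ω)
  choose b hb using hx
  have hdist : Filter.Tendsto (fun n => ‖φ.gnsMap (b n) - ω‖) Filter.atTop (𝓝 0) := by
    simp only [hb]
    exact tendsto_iff_norm_sub_tendsto_zero.1 hxω
  have henergy : ∀ n, ‖φ (star (α.orbitIntegral (b n) T) * (α.act T (b n) - b n))‖ ≤
      2 * ‖φ.gnsMap (b n) - ω‖ * (‖x n‖ + ‖ω‖) * |T - 0| := by
    intro n
    rw [← RCLike.norm_conj, conj_apply_star_orbitIntegral_mul hinv]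
    refine intervalIntegral.norm_integral_le_of_norm_le_const fun t _ => ?_
    rw [hb, norm_sub_rev]
    -- The `⟨ω, U_t ω⟩` terms cancel because this number is real, leaving only terms containing `x n
    -- - ω`.
    have hsplit : inner ℂ (x n) (φ.implementer α t (x n)) -
        inner ℂ (φ.implementer α t (x n)) (x n) =
        (inner ℂ (x n - ω) (φ.implementer α t (x n)) +
          inner ℂ ω (φ.implementer α t (x n - ω))) -
        (inner ℂ (φ.implementer α t (x n)) (x n - ω) +
          inner ℂ (φ.implementer α t (x n - ω)) ω) := by
      simp only [inner_sub_left, inner_sub_right, map_sub, hreal t]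
      ring
    have hU := fun ξ => norm_implementer hinv t ξ
    rw [hsplit]
    refine (norm_sub_le _ _).trans ((add_le_add (norm_add_le _ _) (norm_add_le _ _)).trans ?_)
    refine (add_le_add (add_le_add (norm_inner_le_norm _ _) (norm_inner_le_norm _ _))
      (add_le_add (norm_inner_le_norm _ _) (norm_inner_le_norm _ _))).trans (le_of_eq ?_)
    rw [hU, hU]
    ring
  have henergy_lim : Filter.Tendsto
      (fun n => ‖φ (star (α.orbitIntegral (b n) T) * (α.act T (b n) - b n))‖)
      Filter.atTop (𝓝 0) := by
    refine squeeze_zero (fun n => norm_nonneg _) henergy ?_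
    have h := ((hdist.const_mul 2).mul (hxω.norm.add_const ‖ω‖)).mul_const |T - 0|
    simpa using h
  -- The generator sends the orbit integral of `b n` to `α_T(b n) - b n`, whose GNS vector tends to
  -- `U_T ω - ω`. Its energy tends to zero, so Cauchy–Schwarz makes the limit orthogonal to the
  -- domain.
  have horth : ∀ c d, α.HasGenerator c d →
      inner ℂ (φ.implementer α T ω - ω) (φ.gnsMap c) = 0 := by
    intro c d hc
    have hlim : Filter.Tendsto (fun n => ‖inner ℂ (φ.gnsMap c) (φ.implementer α T (x n) - x n)‖ ^ 2)
        Filter.atTop (𝓝 (‖inner ℂ (φ.gnsMap c) (φ.implementer α T ω - ω)‖ ^ 2)) := by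
      refine Filter.Tendsto.pow (Filter.Tendsto.norm ?_) 2
      exact Filter.Tendsto.inner tendsto_const_nhds
        ((((φ.implementer α T).continuous.tendsto ω).comp hxω).sub hxω)
    have hzero : Filter.Tendsto
        (fun n => ‖inner ℂ (φ.gnsMap c) (φ.implementer α T (x n) - x n)‖ ^ 2)
        Filter.atTop (𝓝 0) := by
      refine squeeze_zero (fun n => sq_nonneg _) (fun n => ?_)
        (by simpa only [mul_zero] using henergy_lim.const_mul (-Complex.I * φ (star c * d)).re)
      have hcs := hφ.norm_sq_le hc (α.hasGenerator_orbitIntegral (b n) T)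
      have heq : inner ℂ (φ.gnsMap c) (φ.implementer α T (x n) - x n) =
          φ (star c * (α.act T (b n) - b n)) := by
        rw [← hb, implementer_gnsMap hinv, ← map_sub, inner_gnsMap]
      rw [heq]
      refine hcs.trans (mul_le_mul_of_nonneg_left ?_ ?_)
      · refine (Complex.re_le_norm _).trans (le_of_eq ?_)
        simp
      · exact (Complex.le_def.1 (isGroundState_generator_iff.1 hφ c d hc)).1
    have h := tendsto_nhds_unique hlim hzero
    rw [← inner_conj_symm, norm_eq_zero.1 (pow_eq_zero_iff two_ne_zero |>.1 h), map_zero]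
  have hall := α.eq_zero_of_forall_hasGenerator
    ((innerSL ℂ (φ.implementer α T ω - ω)).comp φ.gnsCLM) horth
  exact sub_eq_zero.1 (φ.eq_zero_of_inner_gnsMap_eq_zero hall)

/-- The vector `wΩ` of a self-adjoint central operator `w` satisfies the ground state condition. -/
theorem nonneg_of_central {w : φ.toPositive.GNS →L[ℂ] φ.toPositive.GNS}
    (hsa : IsSelfAdjoint w) (hw : ∀ a, Commute (φ.rep a) w)
    (hw' : ∀ T, (∀ a, Commute (φ.rep a) T) → Commute T w) {a d : A} (ha : α.HasGenerator a d) :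
    0 ≤ -Complex.I * inner ℂ (φ.rep a (w (φ.gnsMap 1))) (φ.rep d (w (φ.gnsMap 1))) := by
  have hinv := hφ.apply_act
  have hfix := fun t => hφ.implementer_apply_of_central hsa hw hw' t
  set ω := w (φ.gnsMap 1)
  obtain ⟨x, hx, hxω⟩ := mem_closure_iff_seq_limit.1 (φ.denseRange_gnsMap ω)
  choose b hb using hx
  -- Averaging over unit time puts the approximants in the domain; convergence survives because
  -- `U_t` is isometric and fixes `ω`.
  have hc_lim : Filter.Tendsto (fun n => φ.gnsMap (α.orbitIntegral (b n) 1)) Filter.atTop (𝓝 ω) := by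
    refine tendsto_iff_norm_sub_tendsto_zero.2 (squeeze_zero (fun n => norm_nonneg _) (fun n => ?_)
      (tendsto_iff_norm_sub_tendsto_zero.1 hxω))
    have hcont : Continuous fun t => φ.gnsMap (α.act t (b n)) :=
      φ.gnsCLM.continuous.comp (α.continuous_act (b n))
    have hsub : φ.gnsMap (α.orbitIntegral (b n) 1) - ω =
        ∫ t in (0 : ℝ)..1, (φ.gnsMap (α.act t (b n)) - ω) := by
      rw [intervalIntegral.integral_sub (hcont.intervalIntegrable _ _)
        (continuous_const.intervalIntegrable _ _), ← gnsCLM_apply, α.map_orbitIntegral]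
      simp [gnsCLM_apply]
    rw [hsub]
    refine (intervalIntegral.norm_integral_le_of_norm_le_const (C := ‖x n - ω‖)
      fun t _ => ?_).trans_eq (by simp)
    rw [← implementer_gnsMap hinv, hb]
    nth_rewrite 1 [← hfix t]
    rw [← map_sub, norm_implementer hinv]
  have hd_lim : Filter.Tendsto (fun n => φ.gnsMap (α.act 1 (b n) - b n)) Filter.atTop (𝓝 0) := by
    have h := (((φ.implementer α 1).continuous.tendsto ω).comp hxω).sub hxω
    rw [hfix, sub_self] at h
    refine h.congr fun n => ?_
    rw [Function.comp_apply, ← hb, implementer_gnsMap hinv, map_sub]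
  have hlim : Filter.Tendsto (fun n => -Complex.I *
      inner ℂ (φ.rep a (φ.gnsMap (α.orbitIntegral (b n) 1)))
        (φ.rep d (φ.gnsMap (α.orbitIntegral (b n) 1)) +
          φ.rep a (φ.gnsMap (α.act 1 (b n) - b n)))) Filter.atTop
      (𝓝 (-Complex.I * inner ℂ (φ.rep a ω) (φ.rep d ω + φ.rep a 0))) :=
    Filter.Tendsto.const_mul _ ((((φ.rep a).continuous.tendsto ω).comp hc_lim).inner
      ((((φ.rep d).continuous.tendsto ω).comp hc_lim).add
        (((φ.rep a).continuous.tendsto 0).comp hd_lim)))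
  rw [map_zero, add_zero] at hlim
  -- Each term is the ground state inequality for `a` times the orbit integral, expanded by the
  -- Leibniz rule.
  refine ge_of_tendsto' hlim fun n => ?_
  rw [rep_gnsMap, rep_gnsMap, rep_gnsMap, ← map_add, inner_gnsMap]
  exact isGroundState_generator_iff.1 hφ _ _ (ha.mul (α.hasGenerator_orbitIntegral (b n) 1))

end IsGroundState

/-- A unique ground state is a factor state. -/
theorem IsUniqueGroundState.isFactorState {φ : CStarState A} {α : TimeEvolution A}
    (hφ : φ.IsUniqueGroundState α.generator) : φ.IsFactorState := by
  have hsq : ∀ w : φ.toPositive.GNS →L[ℂ] φ.toPositive.GNS, IsSelfAdjoint w →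
      (∀ a, Commute (φ.rep a) w) → (∀ T, (∀ a, Commute (φ.rep a) T) → Commute T w) →
      ∃ c : ℂ, w * w = c • 1 := by
    intro w hsa hw hw'
    by_cases hω : w (φ.gnsMap 1) = 0
    · have h0 : w = 0 := φ.eq_of_commute_of_apply_eq hw (fun a => Commute.zero_right _) (by simpa)
      exact ⟨0, by simp [h0]⟩
    have hadj : ∀ ξ η, inner ℂ (w ξ) η = inner ℂ ξ (w η) := fun ξ η => by
      rw [← ContinuousLinearMap.adjoint_inner_left, ← ContinuousLinearMap.star_eq_adjoint,
        hsa.star_eq]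
    have hground : (φ.ofVector _ hω).IsGroundState α.generator := by
      refine isGroundState_generator_iff.2 fun a d ha => ?_
      rw [ofVector_apply, mul_smul_comm, map_mul, mul_apply_eq_comp, inner_rep_right, star_star]
      exact smul_nonneg (by positivity) (hφ.1.nonneg_of_central hsa hw hw' ha)
    have heq := hφ.2 _ hground
    have hpos : (‖w (φ.gnsMap 1)‖ ^ 2 : ℝ) ≠ 0 := by positivity
    refine ⟨((‖w (φ.gnsMap 1)‖ ^ 2 : ℝ) : ℂ), φ.eq_of_commute_of_apply_eq
      (fun a => (hw a).mul_right (hw a)) (fun a => (Commute.one_right _).smul_right _) ?_⟩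
    -- Uniqueness gives `⟨ω, π(a)ω⟩ = ‖ω‖² φ(a)`; moving both factors `w` to the left says that
    -- `w²Ω` and `‖ω‖²Ω` pair equally with a dense set.
    refine sub_eq_zero.1 (φ.eq_zero_of_inner_gnsMap_eq_zero fun a => ?_)
    have ha := φ.ofVector_apply _ hω a
    rw [heq, eq_inv_smul_iff₀ hpos] at ha
    have hrw : φ.rep a (w (φ.gnsMap 1)) = w (φ.gnsMap a) := by
      have h := congrArg (fun R : φ.toPositive.GNS →L[ℂ] φ.toPositive.GNS => R (φ.gnsMap 1))
        (hw a).eq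
      simpa only [mul_apply_eq_comp, rep_gnsMap, mul_one] using h
    rw [hrw, ← hadj] at ha
    simp only [mul_apply_eq_comp, smul_apply, one_apply_eq_self, inner_sub_left,
      inner_smul_left, Complex.conj_ofReal, ← ha, inner_gnsMap, star_one, one_mul,
      Complex.real_smul, sub_self]
  have hscalar : ∀ w : φ.toPositive.GNS →L[ℂ] φ.toPositive.GNS, IsSelfAdjoint w →
      (∀ a, Commute (φ.rep a) w) → (∀ T, (∀ a, Commute (φ.rep a) T) → Commute T w) →
      ∃ c : ℂ, w = c • 1 := by
    intro w hsa hw hw'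
    obtain ⟨c, hc⟩ := hsq w hsa hw hw'
    obtain ⟨e, he⟩ := hsq (w + 1) (hsa.add (IsSelfAdjoint.one _))
      (fun a => (hw a).add_right (Commute.one_right _))
      (fun T hT => (hw' T hT).add_right (Commute.one_right _))
    -- Polarization: `2w = (w + 1)² - w² - 1`.
    have h2 : (2 : ℂ) • w = (e - c - 1) • (1 : φ.toPositive.GNS →L[ℂ] φ.toPositive.GNS) := by
      rw [sub_smul, sub_smul, ← he, ← hc, one_smul, two_smul]
      noncomm_ring
    refine ⟨2⁻¹ * (e - c - 1), ?_⟩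
    rw [mul_smul, ← h2, inv_smul_smul₀ two_ne_zero]
  rw [isFactorState_iff]
  intro z hz hz'
  have hstar : ∀ a, Commute (φ.rep a) (star z) := fun a => by
    have h := (hz (star a)).star_star
    rwa [← map_star, star_star] at h
  have hstar' : ∀ T, (∀ a, Commute (φ.rep a) T) → Commute T (star z) := fun T hT => by
    have h := (hz' (star T) fun a => by
      have h := (hT (star a)).star_star
      rwa [← map_star, star_star] at h).star_star
    rwa [star_star] at h
  -- A general central `z` is recovered from the self-adjoint elements `z + z*` and `i(z - z*)`.
  obtain ⟨c, hc⟩ := hscalar (z + star z) (IsSelfAdjoint.add_star_self z)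
    (fun a => (hz a).add_right (hstar a)) (fun T hT => (hz' T hT).add_right (hstar' T hT))
  obtain ⟨e, he⟩ := hscalar (Complex.I • (z - star z))
    (by
      rw [IsSelfAdjoint, star_smul, star_sub, star_star, Complex.star_def, Complex.conj_I,
        neg_smul, ← smul_neg, neg_sub])
    (fun a => ((hz a).sub_right (hstar a)).smul_right _)
    (fun T hT => ((hz' T hT).sub_right (hstar' T hT)).smul_right _)
  refine ⟨2⁻¹ * (c - Complex.I * e), ?_⟩
  have h2 : (2 : ℂ) • z = (c - Complex.I * e) • (1 : φ.toPositive.GNS →L[ℂ] φ.toPositive.GNS) := by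
    rw [sub_smul, mul_smul, ← hc, ← he, smul_smul, Complex.I_mul_I, two_smul]
    simp only [neg_smul, one_smul]
    abel
  rw [mul_smul, ← h2, inv_smul_smul₀ two_ne_zero]

omit [PartialOrder A] [StarOrderedRing A] in
/-- A unique ground state has all the symmetries of the Hamiltonian. -/
theorem IsUniqueGroundState.isInvariant {Γ : Type*} [Group Γ] {φ : CStarState A}
    {δ : A →ₗ.[ℂ] A} {ρ : Γ →* (A ≃⋆ₐ[ℂ] A)} (hφ : φ.IsUniqueGroundState δ)
    (hδ : IsTranslationInvariant δ ρ) : φ.IsInvariant ρ := by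
  intro g a
  let e : A ≃ₗᵢ[ℂ] A :=
    { (ρ g).toAlgEquiv.toLinearEquiv with norm_map' := fun a => StarAlgEquiv.norm_map (ρ g) a }
  have he : ∀ a, e a = ρ g a := fun a => rfl
  let ψ : CStarState A :=
    { toCLM := φ.toCLM.comp (e : A →L[ℂ] A)
      norm_eq_one := by
        rw [ContinuousLinearMap.opNorm_comp_linearIsometryEquiv, φ.norm_eq_one]
      nonneg := fun a => by
        change 0 ≤ φ (e (star a * a))
        rw [he, map_mul, map_star]
        exact φ.nonneg _ }
  have hψ : ∀ a, ψ a = φ (ρ g a) := fun a => rfl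
  have hground : ψ.IsGroundState δ := fun a => by
    obtain ⟨h, h'⟩ := hδ g a
    have := hφ.1 ⟨_, h⟩
    rw [hψ, map_mul, map_star, ← h']
    exact this
  rw [← hψ, hφ.2 ψ hground]

end CStarState
end

theorem mainTheorem12 {Γ : Type*} [Group Γ]
    (S : Finset Γ) (hS : Subgroup.closure (S : Set Γ) = ⊤)
    {A : Type*} [CStarAlgebra A] [PartialOrder A] [StarOrderedRing A]
    (N : DiscreteNet Γ A) (hN : N.LocallyFiniteDimensional)
    (ρ : Γ →* (A ≃⋆ₐ[ℂ] A)) (hρ : N.IsCovariant ρ) :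
    (∀ φ : CStarState A, φ.IsInvariant ρ → φ.IsFactorState →
      (φ.higherCorrelationCoarse N).controlled ⊆
        (CoarseStructure.ofGraph (cayleyGraph (S : Set Γ))).controlled) ∧
    (∀ δ : A →ₗ.[ℂ] A, IsHamiltonian δ → IsTranslationInvariant δ ρ →
      ∀ φ : CStarState A, φ.IsUniqueGroundState δ →
        (φ.higherCorrelationCoarse N).controlled ⊆
          (CoarseStructure.ofGraph (cayleyGraph (S : Set Γ))).controlled) := by
  refine ⟨fun φ hinv hφ => hφ.higherCorrelationCoarse_subset S.finite_toSet hS hN hρ hinv, ?_⟩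
  rintro _ ⟨α, rfl⟩ hδ φ hφ
  exact hφ.isFactorState.higherCorrelationCoarse_subset S.finite_toSet hS hN hρ
    (hφ.isInvariant hδ)
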